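/- There exist universal constants $C, A_0 > 0$ such that the following holds. Let $\psi:\mathbb{R}\to\mathbb{R}$ be 1-periodic with $\int_0^1\psi(x)\,dx=0$ and finite total variation on $[0,1]$, $$\|\psi\|_{BV}=\sup_{0=x_0\le\dots\le x_N=1}\sum_{i=1}^N|\psi(x_i)-\psi(x_{i-1})|<\infty,$$ and put $h_a(x)=\psi(ax)$ for $a\in\{0,1,2,\dots\}$. Let $\Omega\subseteq\mathbb{R}^s$ be open, let $\eta:\Omega\times\mathbb{R}\to\mathbb{R}$ be continuous, and let $\mathbf{w}\in\Omega$ be such that for every $i$ the partial derivative $g_i(\mathbf{w})(x)=\frac{\partial\eta(\mathbf{w},x)}{\partial w_i}$ exists for almost every $x\in[0,1]$ and $g_i(\mathbf{w})\in L_2([0,1])$. Assume moreover that the difference quotients of $\eta$ at $\mathbf{w}$ are bounded in $L_2([0,1])$: there is $K$ with $\|\eta(\mathbf{w}+t\mathbf{e}_i,\cdot)-\eta(\mathbf{w},\cdot)\|_{L_2([0,1])}\le K|t|$ for every standard basis vector $\mathbf{e}_i$ and all $t$ close enough to $0$. Then for every $a$ the gradient (the vector of partial derivatives) $\nabla_{\mathbf{w}}\|\eta(\mathbf{w},\cdot)-h_a\|^2_{L_2([0,1])}$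 exists, and for every integer $A>A_0$ $$\sum_{i=1}^s \mathrm{Var}_{a}\Big[\frac{\partial}{\partial w_i}\|\eta(\mathbf{w},\cdot)-h_a\|^2_{L_2([0,1])}\Big]\le C\,\|g(\mathbf{w})\|^2\,\|\psi\|^2_{BV}\,A^{-1/2}(\log A+1)^{5/2},$$ where $a$ is uniform on $\{0,\dots,A-1\}$, $\|g(\mathbf{w})\|^2=\sum_{i=1}^s\|g_i(\mathbf{w})\|^2_{L_2([0,1])}$, and $C, A_0$ do not depend on $\psi,s,\Omega,\eta,\mathbf{w}$ or $A$. -/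

import Mathlib

open MeasureTheory Set Filter Topology

noncomputable section

namespace HighFreq

/-- The wave `h_a(x) = ψ(a x)` of frequency `a`. -/
def wave (ψ : ℝ → ℝ) (a : ℕ) (x : ℝ) : ℝ := ψ ((a : ℝ) * x)

/-- The square of the `L₂([0,1])` norm of a real function. -/
def normSqL2 (f : ℝ → ℝ) : ℝ := ∫ x in Icc (0 : ℝ) 1, f x ^ 2

/-- The square loss `w ↦ ‖η(w, ·) - h_a‖²` in `L₂([0,1])`, as a function of the weights. -/
def loss {s : ℕ} (ψ : ℝ → ℝ) (η : EuclideanSpace ℝ (Fin s) → ℝ → ℝ) (a : ℕ)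
    (w : EuclideanSpace ℝ (Fin s)) : ℝ :=
  normSqL2 (fun x => η w x - wave ψ a x)

/-- The `i`-th standard basis vector of `ℝ^s`. -/
def basisVec {s : ℕ} (i : Fin s) : EuclideanSpace ℝ (Fin s) := EuclideanSpace.single i (1 : ℝ)

/-- The partial derivative `∂F/∂w_i` at `w`. -/
def partialDeriv {s : ℕ} (i : Fin s) (F : EuclideanSpace ℝ (Fin s) → ℝ)
    (w : EuclideanSpace ℝ (Fin s)) : ℝ :=
  lineDeriv ℝ F w (basisVec i)

/-- The function `g_i(w) = ∂η(w, ·)/∂w_i` of `x`. -/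
def gradFun {s : ℕ} (η : EuclideanSpace ℝ (Fin s) → ℝ → ℝ) (w : EuclideanSpace ℝ (Fin s))
    (i : Fin s) (x : ℝ) : ℝ :=
  partialDeriv i (fun v => η v x) w

/-- `‖g(w)‖² = ∑ i, ‖g_i(w)‖²`. -/
def gradNormSq {s : ℕ} (η : EuclideanSpace ℝ (Fin s) → ℝ → ℝ)
    (w : EuclideanSpace ℝ (Fin s)) : ℝ :=
  ∑ i, normSqL2 (gradFun η w i)

/-- The mean of `X a` for `a` uniform on `{0, …, A - 1}`. -/
def unifMean (A : ℕ) (X : ℕ → ℝ) : ℝ := (∑ a ∈ Finset.range A, X a) / (A : ℝ)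

/-- The variance of `X a` for `a` uniform on `{0, …, A - 1}`. -/
def unifVar (A : ℕ) (X : ℕ → ℝ) : ℝ := unifMean A (fun a => (X a - unifMean A X) ^ 2)

/-- The variance, over `a` uniform on `{0, …, A - 1}`, of the gradient of the square loss:
the sum of the variances of the components of the gradient. -/
def gradVar {s : ℕ} (ψ : ℝ → ℝ) (η : EuclideanSpace ℝ (Fin s) → ℝ → ℝ) (A : ℕ)
    (w : EuclideanSpace ℝ (Fin s)) : ℝ :=
  ∑ i, unifVar A (fun a => partialDeriv i (loss ψ η a) w)

/-- The total variation of `ψ` on `[0,1]`, as a real number. -/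
def bvNorm (ψ : ℝ → ℝ) : ℝ := (eVariationOn ψ (Icc (0 : ℝ) 1)).toReal

end HighFreq

end

noncomputable section

namespace HighFreq

/-! The derivative of the loss along `w_i` is `2∫(η - h_a) g_i`, and only `-2∫ h_a g_i` depends on
`a`. Comparing with the centre `2∫ η g_i` bounds the variance by `(4/A) ∑ₐ (∫ h_a g_i)²`, so it
suffices that the waves are nearly orthogonal.

For coprime `a, b`, substituting `u = a x` and then `u = b x` gives `∫ h_a h_b = (ab)⁻¹ ∫ fold a ψ ·
fold b ψ`. A fold has mean zero and oscillates by at most `‖ψ‖_BV`, because its sample points lie in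
disjoint cells whose variations add up; hence it is bounded by `‖ψ‖_BV` whatever the number of
summands. Rescaling by the gcd gives correlations of at most `‖ψ‖² gcd(a,b)²/(ab)`, with row sums of
at most `‖ψ‖² (1 + log A)²`.

Schur's test (`sum_sq_integral_mul_le`) turns row sums into a Bessel-type inequality. The outcome
has order `A⁻¹ (log A + 1)²`, stronger than required. Differentiability of the loss is separate:
`L²`-bounded difference quotients converging almost everywhere converge in `L¹`, which suffices
against bounded functions. -/

/-! ### Folding and integrals of dilated periodic functions -/

/-- The sum of `F` over the `n` preimages of `u` under multiplication by `n` modulo one. -/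
def fold (n : ℕ) (F : ℝ → ℝ) (u : ℝ) : ℝ := ∑ j ∈ Finset.range n, F ((u + j) / n)

theorem periodic_fold {F : ℝ → ℝ} (hF : Function.Periodic F 1) (n : ℕ) :
    Function.Periodic (fold n F) 1 := by
  intro u
  rcases Nat.eq_zero_or_pos n with rfl | hn
  · simp [fold]
  have hn' : (n : ℝ) ≠ 0 := by positivity
  have h := Finset.sum_range_succ' (fun j : ℕ => F ((u + j) / n)) n
  rw [Finset.sum_range_succ] at h
  have h1 : F ((u + n) / n) = F (u / n) := by
    rw [add_div, div_self hn']; exact hF _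
  simp only [h1, Nat.cast_zero, add_zero] at h
  have h2 := add_right_cancel h
  simp only [fold]
  rw [h2]
  refine Finset.sum_congr rfl fun j _ => ?_
  congr 2; push_cast; ring

theorem integral_fold {F : ℝ → ℝ} (hF : IntervalIntegrable F volume 0 1) {n : ℕ} (hn : 0 < n) :
    ∫ u in (0 : ℝ)..1, fold n F u = n * ∫ x in (0 : ℝ)..1, F x := by
  have hn' : (0 : ℝ) < n := by positivity
  have hsub : ∀ j < n, IntervalIntegrable F volume ((j : ℝ) / n) (((j + 1 : ℕ) : ℝ) / n) := by
    intro j hj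
    refine hF.mono_set ?_
    rw [uIcc_of_le zero_le_one, uIcc_of_le (by gcongr; simp)]
    refine Icc_subset_Icc (by positivity) ?_
    rw [div_le_one hn']; exact_mod_cast hj
  have hsum := intervalIntegral.sum_integral_adjacent_intervals (f := F) (μ := volume)
    (a := fun j : ℕ => (j : ℝ) / n) (n := n) hsub
  simp only [Nat.cast_zero, zero_div, div_self hn'.ne'] at hsum
  have hterm : ∀ j : ℕ, (fun u : ℝ => F ((u + j) / n)) = fun u => F (u / n + (j : ℝ) / n) := by
    intro j; ext u; rw [add_div]
  have hval : ∀ j : ℕ, ∫ u in (0 : ℝ)..1, F ((u + j) / n)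
      = n * ∫ x in (j : ℝ) / n..((j + 1 : ℕ) : ℝ) / n, F x := by
    intro j
    rw [hterm, intervalIntegral.integral_comp_div_add F hn'.ne']
    simp only [smul_eq_mul]
    congr 2
    · simp
    · push_cast; ring
  simp only [fold]
  rw [intervalIntegral.integral_finsetSum, ← hsum, Finset.mul_sum]
  · exact Finset.sum_congr rfl fun j _ => hval j
  · intro j hj
    rw [hterm]
    have h := (hsub j (Finset.mem_range.1 hj)).comp_add_right ((j : ℝ) / n)
    have h' := h.comp_mul_right (c := (n : ℝ)⁻¹)
    convert h' using 1 <;> field_simp <;> push_cast <;> ring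

/-- Modulo `a`, multiplication by the coprime number `b` permutes the residues `j`, and periodicity
of `F` discards the quotients. -/
theorem fold_comp_mul {F : ℝ → ℝ} (hF : Function.Periodic F 1) {a b : ℕ} (ha : 0 < a)
    (hab : Nat.Coprime a b) (u : ℝ) :
    fold a (fun x => F (b * x)) u = fold a F (b * u) := by
  have ha' : (a : ℝ) ≠ 0 := by positivity
  have hmod : ∀ j : ℕ, F (b * ((u + j) / a)) = F ((b * u + ((b * j % a : ℕ) : ℝ)) / a) := by
    intro j
    have h : (b : ℝ) * ((u + j) / a)
        = (b * u + ((b * j % a : ℕ) : ℝ)) / a + ((b * j / a : ℕ) : ℝ) * 1 := by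
      have h0 : ((b * j : ℕ) : ℝ) = a * (b * j / a : ℕ) + (b * j % a : ℕ) := by
        exact_mod_cast (Nat.div_add_mod (b * j) a).symm
      push_cast at h0
      field_simp
      linarith
    rw [h]
    exact hF.nat_mul _ _
  simp only [fold, hmod]
  have hmaps : Set.MapsTo (fun j => b * j % a) (Finset.range a) (Finset.range a) := fun j _ => by
    simpa using Nat.mod_lt _ ha
  have hinj : Set.InjOn (fun j => b * j % a) (Finset.range a) := by
    intro i hi j hj hij
    simp only [Finset.coe_range, Set.mem_Iio] at hi hj
    have h : i ≡ j [MOD a] := Nat.ModEq.cancel_left_of_coprime hab hij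
    rwa [Nat.ModEq, Nat.mod_eq_of_lt hi, Nat.mod_eq_of_lt hj] at h
  exact Finset.sum_nbij (fun j => b * j % a) hmaps hinj
    (Finset.surjOn_of_injOn_of_card_le _ hmaps hinj le_rfl) fun j _ => rfl

/-- At all `n` preimages of `u` the factor `F (n * x)` takes the same value `F u`, so it comes out
of the fold of the product. -/
theorem integral_mul_comp_mul {F G : ℝ → ℝ} (hF : Function.Periodic F 1) {n : ℕ} (hn : 0 < n)
    (hFG : IntervalIntegrable (fun x => F (n * x) * G x) volume 0 1) :
    ∫ x in (0 : ℝ)..1, F (n * x) * G x = (∫ u in (0 : ℝ)..1, F u * fold n G u) / n := by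
  have hn' : (n : ℝ) ≠ 0 := by positivity
  rw [eq_div_iff hn', mul_comm, ← integral_fold hFG hn]
  congr 1
  ext u
  simp only [fold, Finset.mul_sum]
  refine Finset.sum_congr rfl fun j _ => ?_
  have h : F (n * ((u + j) / n)) = F u := by
    rw [mul_div_cancel₀ _ hn']
    simpa using hF.nat_mul j u
  rw [h]

theorem integral_comp_nat_mul {F : ℝ → ℝ} (hF : Function.Periodic F 1) {n : ℕ} (hn : 0 < n)
    (hFi : IntervalIntegrable (fun x => F (n * x)) volume 0 1) :
    ∫ x in (0 : ℝ)..1, F (n * x) = ∫ u in (0 : ℝ)..1, F u := by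
  have hn' : (n : ℝ) ≠ 0 := by positivity
  have h := integral_mul_comp_mul (G := fun _ => 1) hF hn (by simpa using hFi)
  simp only [mul_one, fold, Finset.sum_const, Finset.card_range, nsmul_eq_mul] at h
  rw [h, intervalIntegral.integral_mul_const, mul_div_cancel_right₀ _ hn']

/-! ### Measurability and uniform bounds from bounded variation -/

theorem intervalIntegrable_of_bounded {F : ℝ → ℝ} (hF : Measurable F) {B : ℝ}
    (hB : ∀ x, |F x| ≤ B) (a b : ℝ) : IntervalIntegrable F volume a b := by
  rw [intervalIntegrable_iff]
  exact Measure.integrableOn_of_bounded (M := B) (by simp) hF.aestronglyMeasurable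
    (Eventually.of_forall hB)

/-- A `1`-periodic function of bounded variation over a period is measurable. -/
theorem measurable_of_periodic_of_boundedVariationOn {F : ℝ → ℝ} (hF : Function.Periodic F 1)
    (hbv : BoundedVariationOn F (Icc 0 1)) : Measurable F := by
  obtain ⟨p, q, hp, hq, hpq⟩ := hbv.locallyBoundedVariationOn.exists_monotoneOn_sub_monotoneOn
  have hmeas : ∀ r : ℝ → ℝ, MonotoneOn r (Icc 0 1) →
      Measurable (IccExtend (zero_le_one' ℝ) ((Icc (0 : ℝ) 1).domRestrict r)) := by
    intro r hr
    refine (Monotone.IccExtend _ ?_).measurable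
    exact fun x y hxy => hr x.2 y.2 hxy
  -- By periodicity `F` factors through the fractional part, so the Jordan decomposition on a single
  -- period is enough.
  have h : F = fun x => (IccExtend (zero_le_one' ℝ) ((Icc (0 : ℝ) 1).domRestrict p)) (Int.fract x)
      - (IccExtend (zero_le_one' ℝ) ((Icc (0 : ℝ) 1).domRestrict q)) (Int.fract x) := by
    ext x
    have hx : Int.fract x ∈ Icc (0 : ℝ) 1 := ⟨Int.fract_nonneg x, (Int.fract_lt_one x).le⟩
    rw [IccExtend_of_mem _ _ hx, IccExtend_of_mem _ _ hx]
    have : F (Int.fract x) = F x := by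
      have := hF.sub_int_mul_eq (x := x) ⌊x⌋
      rw [mul_one] at this
      exact this
    rw [← this, hpq]; rfl
  rw [h]
  exact ((hmeas p hp).comp measurable_fract).sub ((hmeas q hq).comp measurable_fract)

theorem measurable_fold {F : ℝ → ℝ} (hF : Measurable F) (n : ℕ) : Measurable (fold n F) := by
  unfold fold
  fun_prop

/-- The `j`-th sample points for `u` and `v` share the cell `[j/n, (j+1)/n]`, and the variations
over the cells sum to the variation on `[0,1]`. -/
theorem abs_fold_sub_fold_le {F : ℝ → ℝ} (hbv : BoundedVariationOn F (Icc 0 1)) (n : ℕ)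
    {u v : ℝ} (hu : u ∈ Icc (0 : ℝ) 1) (hv : v ∈ Icc (0 : ℝ) 1) :
    |fold n F u - fold n F v| ≤ bvNorm F := by
  rcases Nat.eq_zero_or_pos n with rfl | hn
  · simp [fold, bvNorm]
  have hn' : (0 : ℝ) < n := by positivity
  have hmono : Monotone (fun j : ℕ => (j : ℝ) / n) := fun i j hij => by
    show (i : ℝ) / n ≤ j / n
    gcongr
  have hsum := eVariationOn.sum' F hmono (n := n)
  simp only [Nat.cast_zero, zero_div, div_self hn'.ne'] at hsum
  have hmem : ∀ w ∈ Icc (0 : ℝ) 1, ∀ j : ℕ,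
      (w + j) / n ∈ Icc ((j : ℝ) / n) (((j + 1 : ℕ) : ℝ) / n) := by
    rintro w ⟨hw0, hw1⟩ j
    constructor
    · gcongr; linarith
    · gcongr; push_cast; linarith
  have hfin : ∀ j ∈ Finset.range n,
      eVariationOn F (Icc ((j : ℝ) / n) (((j + 1 : ℕ) : ℝ) / n)) ≠ ⊤ := by
    intro j hj
    refine (hbv.mono (Icc_subset_Icc (by positivity) ?_))
    rw [div_le_one hn']
    exact_mod_cast Finset.mem_range.1 hj
  rw [bvNorm, ← hsum, ENNReal.toReal_sum hfin]
  simp only [fold]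
  rw [← Finset.sum_sub_distrib]
  refine (Finset.abs_sum_le_sum_abs _ _).trans (Finset.sum_le_sum fun j hj => ?_)
  rw [← Real.dist_eq]
  exact BoundedVariationOn.dist_le (hfin j hj) (hmem u hu j) (hmem v hv j)

theorem intervalIntegrable_of_abs_sub_le {F : ℝ → ℝ} {V : ℝ} (hm : Measurable F)
    (hosc : ∀ u ∈ Icc (0 : ℝ) 1, ∀ v ∈ Icc (0 : ℝ) 1, |F u - F v| ≤ V) :
    IntervalIntegrable F volume 0 1 := by
  rw [intervalIntegrable_iff]
  refine Measure.integrableOn_of_bounded (M := |F 0| + V) (by simp) hm.aestronglyMeasurable ?_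
  filter_upwards [ae_restrict_mem measurableSet_uIoc] with u hu
  rw [uIoc_of_le zero_le_one] at hu
  have h := hosc u (Ioc_subset_Icc_self hu) 0 (by simp)
  have h2 := abs_sub_abs_le_abs_sub (F u) (F 0)
  rw [Real.norm_eq_abs]
  linarith

/-- With mean zero, `F y` is the average over `v` of `F y - F v`. -/
theorem abs_le_of_integral_eq_zero {F : ℝ → ℝ} {V : ℝ} (hper : Function.Periodic F 1)
    (hm : Measurable F) (h0 : ∫ x in (0 : ℝ)..1, F x = 0)
    (hosc : ∀ u ∈ Icc (0 : ℝ) 1, ∀ v ∈ Icc (0 : ℝ) 1, |F u - F v| ≤ V) (x : ℝ) :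
    |F x| ≤ V := by
  obtain ⟨y, hy, hxy⟩ := hper.exists_mem_Ico₀ one_pos x
  rw [hxy]
  have h1 : F y = ∫ v in (0 : ℝ)..1, (F y - F v) := by
    rw [intervalIntegral.integral_sub (by simp) (intervalIntegrable_of_abs_sub_le hm hosc), h0]
    simp
  rw [h1]
  have := intervalIntegral.norm_integral_le_of_norm_le_const (a := 0) (b := 1)
    (f := fun v => F y - F v) (C := V) (fun v hv => by
      rw [uIoc_of_le zero_le_one] at hv
      exact hosc y (Ico_subset_Icc_self hy) v (Ioc_subset_Icc_self hv))
  simpa using this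

theorem abs_sub_le_bvNorm {ψ : ℝ → ℝ} (hbv : BoundedVariationOn ψ (Icc (0 : ℝ) 1)) :
    ∀ u ∈ Icc (0 : ℝ) 1, ∀ v ∈ Icc (0 : ℝ) 1, |ψ u - ψ v| ≤ bvNorm ψ :=
  fun _ hu _ hv => hbv.dist_le hu hv

theorem abs_le_bvNorm {ψ : ℝ → ℝ} (hper : Function.Periodic ψ 1)
    (hbv : BoundedVariationOn ψ (Icc (0 : ℝ) 1)) (hmean : ∫ x in (0 : ℝ)..1, ψ x = 0) (x : ℝ) :
    |ψ x| ≤ bvNorm ψ :=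
  abs_le_of_integral_eq_zero hper (measurable_of_periodic_of_boundedVariationOn hper hbv) hmean
    (abs_sub_le_bvNorm hbv) x

theorem abs_fold_le_bvNorm {ψ : ℝ → ℝ} (hper : Function.Periodic ψ 1)
    (hbv : BoundedVariationOn ψ (Icc (0 : ℝ) 1)) (hmean : ∫ x in (0 : ℝ)..1, ψ x = 0)
    {n : ℕ} (hn : 0 < n) (x : ℝ) : |fold n ψ x| ≤ bvNorm ψ := by
  have hm := measurable_of_periodic_of_boundedVariationOn hper hbv
  refine abs_le_of_integral_eq_zero (periodic_fold hper n) (measurable_fold hm n) ?_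
    (fun u hu v hv => abs_fold_sub_fold_le hbv n hu hv) x
  rw [integral_fold (intervalIntegrable_of_abs_sub_le hm (abs_sub_le_bvNorm hbv)) hn, hmean,
    mul_zero]

theorem bvNorm_nonneg (ψ : ℝ → ℝ) : 0 ≤ bvNorm ψ := ENNReal.toReal_nonneg

/-! ### Correlations of waves -/

theorem abs_integral_wave_mul_wave_le_of_coprime {ψ : ℝ → ℝ} (hper : Function.Periodic ψ 1)
    (hbv : BoundedVariationOn ψ (Icc (0 : ℝ) 1)) (hmean : ∫ x in (0 : ℝ)..1, ψ x = 0)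
    {a b : ℕ} (ha : 0 < a) (hb : 0 < b) (hab : Nat.Coprime a b) :
    |∫ x in (0 : ℝ)..1, wave ψ a x * wave ψ b x| ≤ bvNorm ψ ^ 2 / (a * b) := by
  have hm := measurable_of_periodic_of_boundedVariationOn hper hbv
  have hV := bvNorm_nonneg ψ
  have hbd := abs_le_bvNorm hper hbv hmean
  have hfa := fun x => abs_fold_le_bvNorm hper hbv hmean ha x
  have hfb := fun x => abs_fold_le_bvNorm hper hbv hmean hb x
  have hmul : ∀ {r t : ℝ}, |r| ≤ bvNorm ψ → |t| ≤ bvNorm ψ → |r * t| ≤ bvNorm ψ ^ 2 := by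
    intro r t hr ht
    rw [abs_mul, sq]
    exact mul_le_mul hr ht (abs_nonneg _) hV
  have hfm := measurable_fold hm a
  have key : ∫ x in (0 : ℝ)..1, wave ψ a x * wave ψ b x
      = (∫ u in (0 : ℝ)..1, fold a ψ u * fold b ψ u) / b / a := by
    simp only [wave]
    rw [integral_mul_comp_mul (G := fun x => ψ (b * x)) hper ha
      (intervalIntegrable_of_bounded (by fun_prop) (fun x => hmul (hbd _) (hbd _)) 0 1)]
    simp_rw [fold_comp_mul hper ha hab, mul_comm (ψ _)]
    rw [integral_mul_comp_mul (periodic_fold hper a) hb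
      (intervalIntegrable_of_bounded (by fun_prop) (fun x => hmul (hfa _) (hbd _)) 0 1)]
  have hbound : |∫ u in (0 : ℝ)..1, fold a ψ u * fold b ψ u| ≤ bvNorm ψ ^ 2 := by
    have := intervalIntegral.norm_integral_le_of_norm_le_const (a := 0) (b := 1)
      (f := fun u => fold a ψ u * fold b ψ u) (C := bvNorm ψ ^ 2)
      (fun v _ => hmul (hfa v) (hfb v))
    simpa using this
  rw [key, abs_div, abs_div, Nat.abs_cast, Nat.abs_cast, div_div, mul_comm (b : ℝ)]
  gcongr

/-- Waves of frequencies `a` and `b` have correlation at most `‖ψ‖² gcd(a, b)² / (a b)`. -/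
theorem abs_integral_wave_mul_wave_le {ψ : ℝ → ℝ} (hper : Function.Periodic ψ 1)
    (hbv : BoundedVariationOn ψ (Icc (0 : ℝ) 1)) (hmean : ∫ x in (0 : ℝ)..1, ψ x = 0)
    {a b : ℕ} (ha : 0 < a) (hb : 0 < b) :
    |∫ x in (0 : ℝ)..1, wave ψ a x * wave ψ b x|
      ≤ bvNorm ψ ^ 2 * (((a / a.gcd b : ℕ) : ℝ)⁻¹ * ((b / a.gcd b : ℕ) : ℝ)⁻¹) := by
  have hm := measurable_of_periodic_of_boundedVariationOn hper hbv
  have hV := bvNorm_nonneg ψ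
  have hbd := abs_le_bvNorm hper hbv hmean
  obtain ⟨d, hd⟩ : ∃ d, d = a.gcd b := ⟨_, rfl⟩
  have hd0 : 0 < d := hd ▸ Nat.gcd_pos_of_pos_left b ha
  have hda : d ∣ a := hd ▸ Nat.gcd_dvd_left a b
  have hdb : d ∣ b := hd ▸ Nat.gcd_dvd_right a b
  have hcop : Nat.Coprime (a / d) (b / d) := by
    rw [hd] at hd0 ⊢
    exact Nat.coprime_div_gcd_div_gcd hd0
  -- The product of waves is a 1-periodic function of `d * x`, and dilation by `d` preserves its
  -- integral, which leaves the coprime case.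
  have hcomp : ∀ x : ℝ, wave ψ a x * wave ψ b x
      = (fun y => wave ψ (a / d) y * wave ψ (b / d) y) (d * x) := by
    intro x
    have h1 : (a : ℝ) = ((a / d : ℕ) : ℝ) * d := by exact_mod_cast (Nat.div_mul_cancel hda).symm
    have h2 : (b : ℝ) = ((b / d : ℕ) : ℝ) * d := by exact_mod_cast (Nat.div_mul_cancel hdb).symm
    simp only [wave]
    rw [← mul_assoc, ← mul_assoc, ← h1, ← h2]
  have hwper : ∀ n : ℕ, Function.Periodic (wave ψ n) 1 := by
    intro n x
    have := hper.nat_mul n (n * x)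
    simpa [wave, mul_add] using this
  have hint : IntervalIntegrable
      (fun x => (fun y => wave ψ (a / d) y * wave ψ (b / d) y) (d * x)) volume 0 1 := by
    refine intervalIntegrable_of_bounded (B := bvNorm ψ * bvNorm ψ) (by unfold wave; fun_prop)
      (fun x => ?_) 0 1
    rw [abs_mul]
    exact mul_le_mul (hbd _) (hbd _) (abs_nonneg _) hV
  simp_rw [hcomp]
  rw [integral_comp_nat_mul (F := fun y => wave ψ (a / d) y * wave ψ (b / d) y)
    (fun x => by simp only [hwper _ x]) hd0 hint, ← hd, ← mul_inv, ← div_eq_mul_inv]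
  exact abs_integral_wave_mul_wave_le_of_coprime hper hbv hmean
    (Nat.div_pos (Nat.le_of_dvd ha hda) hd0) (Nat.div_pos (Nat.le_of_dvd hb hdb) hd0) hcop

/-! ### Row sums, Schur's test and the Bessel-type inequality -/

/-- For fixed `a`, the reduced pair `(a/g, b/g)` determines `b`: its first entry gives the gcd `g`,
its second then gives `b`. The sum is thus part of the square of a harmonic sum. -/
theorem sum_inv_div_gcd_le {A a : ℕ} (ha : a ∈ Finset.Ico 1 A) :
    ∑ b ∈ Finset.Ico 1 A, ((a / a.gcd b : ℕ) : ℝ)⁻¹ * ((b / a.gcd b : ℕ) : ℝ)⁻¹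
      ≤ (1 + Real.log A) ^ 2 := by
  have hH : ∑ n ∈ Finset.Ico 1 A, (n : ℝ)⁻¹ ≤ 1 + Real.log A := by
    have h := harmonic_le_one_add_log A
    rw [harmonic_eq_sum_Icc] at h
    push_cast at h
    refine (Finset.sum_le_sum_of_subset_of_nonneg ?_ fun _ _ _ => by positivity).trans h
    intro n hn
    simp only [Finset.mem_Ico, Finset.mem_Icc] at hn ⊢
    omega
  have ha' := Finset.mem_Ico.1 ha
  have hinj : Set.InjOn (fun b => (a / a.gcd b, b / a.gcd b)) (Finset.Ico 1 A) := by
    intro b hb c hc hbc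
    simp only [Prod.mk.injEq] at hbc
    have hg : a.gcd b = a.gcd c := by
      have h1 := Nat.div_mul_cancel (Nat.gcd_dvd_left a b)
      have h2 := Nat.div_mul_cancel (Nat.gcd_dvd_left a c)
      rw [hbc.1] at h1
      have hpos := Nat.div_pos (Nat.gcd_le_left c ha'.1) (Nat.gcd_pos_of_pos_left c ha'.1)
      exact Nat.eq_of_mul_eq_mul_left hpos (h1.trans h2.symm)
    rw [← Nat.div_mul_cancel (Nat.gcd_dvd_right a b), hbc.2, hg,
      Nat.div_mul_cancel (Nat.gcd_dvd_right a c)]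
  calc ∑ b ∈ Finset.Ico 1 A, ((a / a.gcd b : ℕ) : ℝ)⁻¹ * ((b / a.gcd b : ℕ) : ℝ)⁻¹
      = ∑ p ∈ (Finset.Ico 1 A).image (fun b => (a / a.gcd b, b / a.gcd b)),
          ((p.1 : ℕ) : ℝ)⁻¹ * ((p.2 : ℕ) : ℝ)⁻¹ := by rw [Finset.sum_image hinj]
    _ ≤ ∑ p ∈ Finset.Ico 1 A ×ˢ Finset.Ico 1 A, ((p.1 : ℕ) : ℝ)⁻¹ * ((p.2 : ℕ) : ℝ)⁻¹ := by
        refine Finset.sum_le_sum_of_subset_of_nonneg ?_ fun _ _ _ => by positivity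
        intro p hp
        obtain ⟨b, hb, rfl⟩ := Finset.mem_image.1 hp
        have hb' := Finset.mem_Ico.1 hb
        have hg := Nat.gcd_pos_of_pos_left b ha'.1
        simp only [Finset.mem_product, Finset.mem_Ico]
        exact ⟨⟨Nat.div_pos (Nat.gcd_le_left b ha'.1) hg, (Nat.div_le_self _ _).trans_lt ha'.2⟩,
          Nat.div_pos (Nat.gcd_le_right a hb'.1) hg, (Nat.div_le_self _ _).trans_lt hb'.2⟩
    _ = (∑ n ∈ Finset.Ico 1 A, (n : ℝ)⁻¹) ^ 2 := by
        rw [sq, Finset.sum_mul_sum, Finset.sum_product]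
    _ ≤ _ := by
        have : 0 ≤ ∑ n ∈ Finset.Ico 1 A, (n : ℝ)⁻¹ := Finset.sum_nonneg fun _ _ => by positivity
        gcongr

/-- Schur's test for the Gram matrix of a finite family of bounded functions. -/
theorem sum_sq_integral_mul_le {α ι : Type*} [MeasurableSpace α] {μ : Measure α}
    [IsFiniteMeasure μ] {s : Finset ι} {h : ι → α → ℝ} {g : α → ℝ} {B M : ℝ}
    (hm : ∀ i, Measurable (h i)) (hB : ∀ i x, |h i x| ≤ B) (hg : MemLp g 2 μ) (hM : 0 < M)
    (hrow : ∀ i ∈ s, ∑ j ∈ s, |∫ x, h i x * h j x ∂μ| ≤ M) :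
    ∑ i ∈ s, (∫ x, h i x * g x ∂μ) ^ 2 ≤ M * ∫ x, g x ^ 2 ∂μ := by
  have hgi : Integrable g μ := hg.integrable one_le_two
  have hg2 : Integrable (fun x => g x ^ 2) μ := hg.integrable_sq
  have hhg : ∀ i, Integrable (fun x => h i x * g x) μ := fun i =>
    hgi.bdd_mul (hm i).aestronglyMeasurable (Eventually.of_forall (hB i))
  have hhi : ∀ i, Integrable (h i) μ := fun i =>
    Integrable.of_bound (hm i).aestronglyMeasurable B (Eventually.of_forall (hB i))
  have hhh : ∀ i j, Integrable (fun x => h i x * h j x) μ := fun i j =>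
    (hhi j).bdd_mul (hm i).aestronglyMeasurable (Eventually.of_forall (hB i))
  let c : ι → ℝ := fun i => ∫ x, h i x * g x ∂μ
  -- Expand `0 ≤ ‖M g - ∑ c_i h_i‖²` with `c_i = ⟨h_i, g⟩`; the Gram term is at most `M ∑ c_i²`,
  -- leaving `M²‖g‖² - M ∑ c_i² ≥ 0`.
  have hexp : ∀ x, (M * g x - ∑ i ∈ s, c i * h i x) ^ 2
      = M ^ 2 * g x ^ 2 - 2 * M * ∑ i ∈ s, c i * (h i x * g x)
        + ∑ i ∈ s, ∑ j ∈ s, c i * c j * (h i x * h j x) := by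
    intro x
    have h1 : ∑ i ∈ s, ∑ j ∈ s, c i * c j * (h i x * h j x) = (∑ i ∈ s, c i * h i x) ^ 2 := by
      rw [sq, Finset.sum_mul_sum]
      exact Finset.sum_congr rfl fun i _ => Finset.sum_congr rfl fun j _ => by ring
    have h2 : ∑ i ∈ s, c i * (h i x * g x) = (∑ i ∈ s, c i * h i x) * g x := by
      rw [Finset.sum_mul]
      exact Finset.sum_congr rfl fun i _ => by ring
    rw [h1, h2]; ring
  have hpos : 0 ≤ ∫ x, (M * g x - ∑ i ∈ s, c i * h i x) ^ 2 ∂μ :=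
    integral_nonneg fun x => sq_nonneg _
  have hI1 : Integrable (fun x => ∑ i ∈ s, c i * (h i x * g x)) μ :=
    integrable_finsetSum _ fun i _ => (hhg i).const_mul _
  have hI2 : Integrable (fun x => ∑ i ∈ s, ∑ j ∈ s, c i * c j * (h i x * h j x)) μ :=
    integrable_finsetSum _ fun i _ => integrable_finsetSum _ fun j _ => (hhh i j).const_mul _
  have hI3 : Integrable
      (fun x => M ^ 2 * g x ^ 2 - 2 * M * ∑ i ∈ s, c i * (h i x * g x)) μ :=
    (hg2.const_mul _).sub (hI1.const_mul _)
  simp_rw [hexp] at hpos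
  rw [integral_add hI3 hI2, integral_sub (hg2.const_mul _) (hI1.const_mul _), integral_const_mul, integral_const_mul,
    integral_finsetSum _ (fun i _ => (hhg i).const_mul _),
    integral_finsetSum _ (fun i _ => integrable_finsetSum _ fun j _ => (hhh i j).const_mul _)] at hpos
  simp_rw [integral_finsetSum _ (fun j _ => (hhh _ j).const_mul _), integral_const_mul] at hpos
  have hdiag : ∑ i ∈ s, c i * ∫ x, h i x * g x ∂μ = ∑ i ∈ s, c i ^ 2 :=
    Finset.sum_congr rfl fun i _ => (sq _).symm
  rw [hdiag] at hpos
  have hquad : ∑ i ∈ s, ∑ j ∈ s, c i * c j * ∫ x, h i x * h j x ∂μ ≤ M * ∑ i ∈ s, c i ^ 2 := by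
    -- From `|c_i c_j| ≤ (c_i² + c_j²)/2`; swapping the indices in the second half makes both halves
    -- row sums.
    have hpt : ∀ i ∈ s, ∀ j ∈ s, c i * c j * ∫ x, h i x * h j x ∂μ
        ≤ c i ^ 2 / 2 * |∫ x, h i x * h j x ∂μ| + c j ^ 2 / 2 * |∫ x, h j x * h i x ∂μ| := by
      intro i _ j _
      have hsymm : ∫ x, h j x * h i x ∂μ = ∫ x, h i x * h j x ∂μ := by simp_rw [mul_comm]
      rw [hsymm, ← add_mul]
      refine (le_abs_self _).trans ?_
      rw [abs_mul]
      refine mul_le_mul_of_nonneg_right ?_ (abs_nonneg _)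
      rw [abs_le]
      constructor <;> nlinarith [sq_nonneg (c i + c j), sq_nonneg (c i - c j)]
    calc _ ≤ ∑ i ∈ s, ∑ j ∈ s, (c i ^ 2 / 2 * |∫ x, h i x * h j x ∂μ|
            + c j ^ 2 / 2 * |∫ x, h j x * h i x ∂μ|) :=
          Finset.sum_le_sum fun i hi => Finset.sum_le_sum fun j hj => hpt i hi j hj
      _ = ∑ i ∈ s, c i ^ 2 * ∑ j ∈ s, |∫ x, h i x * h j x ∂μ| := by
          simp_rw [Finset.sum_add_distrib]
          rw [Finset.sum_comm (f := fun i j => c j ^ 2 / 2 * |∫ x, h j x * h i x ∂μ|),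
            ← Finset.sum_add_distrib]
          refine Finset.sum_congr rfl fun i _ => ?_
          rw [← Finset.mul_sum, ← add_mul, add_halves]
      _ ≤ ∑ i ∈ s, c i ^ 2 * M :=
          Finset.sum_le_sum fun i hi => mul_le_mul_of_nonneg_left (hrow i hi) (sq_nonneg _)
      _ = M * ∑ i ∈ s, c i ^ 2 := by rw [← Finset.sum_mul, mul_comm]
  have hfin : 0 ≤ M * (M * (∫ x, g x ^ 2 ∂μ) - ∑ i ∈ s, c i ^ 2) := by nlinarith
  have := nonneg_of_mul_nonneg_right hfin hM
  linarith

theorem sum_sq_integral_wave_mul_le {ψ : ℝ → ℝ} (hper : Function.Periodic ψ 1)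
    (hbv : BoundedVariationOn ψ (Icc (0 : ℝ) 1)) (hmean : ∫ x in (0 : ℝ)..1, ψ x = 0)
    {g : ℝ → ℝ} (hg : MemLp g 2 (volume.restrict (Icc (0 : ℝ) 1))) {A : ℕ} (hA : 0 < A) :
    ∑ a ∈ Finset.range A, (∫ x in Icc (0 : ℝ) 1, wave ψ a x * g x) ^ 2
      ≤ 2 * (bvNorm ψ ^ 2 * (1 + Real.log A) ^ 2) * normSqL2 g := by
  have hbd := abs_le_bvNorm hper hbv hmean
  have hL : 1 ≤ 1 + Real.log A := by
    have := Real.log_natCast_nonneg A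
    linarith
  have hG : 0 ≤ normSqL2 g := integral_nonneg fun x => sq_nonneg _
  -- Schur's test needs `M > 0`; if the variation vanishes, so does `ψ`.
  rcases (bvNorm_nonneg ψ).eq_or_lt with hV | hV
  · have h0 : ∀ x, ψ x = 0 := fun x => abs_nonpos_iff.1 (hV ▸ hbd x)
    simp [wave, h0, ← hV]
  have hm : ∀ a, Measurable (wave ψ a) := fun a => by
    have := measurable_of_periodic_of_boundedVariationOn hper hbv
    unfold wave
    fun_prop
  have hB : ∀ a x, |wave ψ a x| ≤ bvNorm ψ := fun a x => hbd _
  -- Frequency `0` gives the constant `ψ 0`, outside the gcd estimate. Treating it alone costs the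
  -- factor `2` in the conclusion.
  have hzero := sum_sq_integral_mul_le (s := {0}) (M := bvNorm ψ ^ 2) hm hB hg (by positivity) (by
    simp only [Finset.mem_singleton, forall_eq, Finset.sum_singleton, wave, Nat.cast_zero, zero_mul]
    simp only [integral_const, smul_eq_mul, MeasurableSet.univ, measureReal_restrict_apply,
      univ_inter, Real.volume_real_Icc, sub_zero, zero_le_one, sup_of_le_left, one_mul]
    rw [← sq, abs_sq, ← sq_abs]
    gcongr
    exact hbd 0)
  have hpos := sum_sq_integral_mul_le (s := Finset.Ico 1 A)
    (M := bvNorm ψ ^ 2 * (1 + Real.log A) ^ 2) hm hB hg (by positivity) (fun a ha => by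
      refine le_trans ?_
        (mul_le_mul_of_nonneg_left (sum_inv_div_gcd_le ha) (sq_nonneg (bvNorm ψ)))
      rw [Finset.mul_sum]
      refine Finset.sum_le_sum fun b hb => ?_
      rw [integral_Icc_eq_integral_Ioc, ← intervalIntegral.integral_of_le zero_le_one]
      exact abs_integral_wave_mul_wave_le hper hbv hmean (Finset.mem_Ico.1 ha).1
        (Finset.mem_Ico.1 hb).1)
  rw [Finset.range_eq_Ico, Finset.sum_eq_sum_Ico_succ_bot hA]
  rw [Finset.sum_singleton] at hzero
  have hle : bvNorm ψ ^ 2 * normSqL2 g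
      ≤ bvNorm ψ ^ 2 * (1 + Real.log A) ^ 2 * normSqL2 g := by
    refine mul_le_mul_of_nonneg_right ?_ hG
    exact le_mul_of_one_le_right (sq_nonneg _) (one_le_pow₀ hL)
  simp only [normSqL2] at *
  rw [zero_add]
  linarith

/-! ### Differentiating the square loss -/

section Differentiation

variable {α : Type*} [MeasurableSpace α] {μ : Measure α} [IsFiniteMeasure μ]

/-- An `L²`-bounded family converging to zero almost everywhere converges to zero in `L¹`. -/
theorem tendsto_integral_abs_zero_of_integral_sq_le {T : Type*} {l : Filter T}
    [l.IsCountablyGenerated] {f : T → α → ℝ} {K : ℝ} (hf : ∀ᶠ t in l, MemLp (f t) 2 μ)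
    (hK : ∀ᶠ t in l, ∫ x, f t x ^ 2 ∂μ ≤ K)
    (hlim : ∀ᵐ x ∂μ, Tendsto (fun t => f t x) l (𝓝 0)) :
    Tendsto (fun t => ∫ x, |f t x| ∂μ) l (𝓝 0) := by
  -- Dominated convergence handles the truncations; `|f| ≤ min |f| N + f²/N` then controls the tail
  -- uniformly by the `L²` bound.
  have htrunc : ∀ N : ℝ, 0 < N → Tendsto (fun t => ∫ x, min |f t x| N ∂μ) l (𝓝 0) := by
    intro N hN
    have h := tendsto_integral_filter_of_dominated_convergence (μ := μ) (l := l)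
      (F := fun t x => min |f t x| N) (f := fun _ => 0) (fun _ => N)
      (hf.mono fun t ht => (ht.aestronglyMeasurable.norm.inf aestronglyMeasurable_const))
      (Eventually.of_forall fun t => Eventually.of_forall fun x => by
        rw [Real.norm_of_nonneg (le_min (abs_nonneg _) hN.le)]
        exact min_le_right _ _)
      (integrable_const N)
      (hlim.mono fun x hx => by
        have h1 := (hx.abs).min (tendsto_const_nhds (x := N))
        simpa [hN.le] using h1)
    simpa using h
  rw [Metric.tendsto_nhds]
  intro ε hε
  have hC : 0 < |K| + 1 := by positivity
  obtain ⟨N, hN⟩ : ∃ N, N = 2 * (|K| + 1) / ε := ⟨_, rfl⟩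
  have hN0 : 0 < N := by rw [hN]; positivity
  have hlt := (htrunc N hN0).eventually (gt_mem_nhds (half_pos hε))
  filter_upwards [hf, hK, hlt] with t ht hKt hltt
  have hi1 : Integrable (fun x => |f t x|) μ := (ht.integrable one_le_two).abs
  have hi2 : Integrable (fun x => min |f t x| N) μ := hi1.inf (integrable_const N)
  have hi3 : Integrable (fun x => f t x ^ 2 / N) μ := ht.integrable_sq.div_const N
  have hle : ∫ x, |f t x| ∂μ ≤ ∫ x, min |f t x| N ∂μ + (∫ x, f t x ^ 2 ∂μ) / N := by
    rw [← integral_div, ← integral_add hi2 hi3]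
    refine integral_mono hi1 (hi2.add hi3) fun x => ?_
    beta_reduce
    rcases le_total |f t x| N with h | h
    · rw [min_eq_left h]
      have : 0 ≤ f t x ^ 2 / N := by positivity
      linarith
    · rw [min_eq_right h]
      have : |f t x| ≤ f t x ^ 2 / N := by
        rw [le_div_iff₀ hN0, ← sq_abs, sq]
        gcongr
      linarith
  have hKN : (∫ x, f t x ^ 2 ∂μ) / N < ε / 2 := by
    rw [div_lt_iff₀ hN0, hN]
    have : ε / 2 * (2 * (|K| + 1) / ε) = |K| + 1 := by field_simp
    rw [this]
    have := le_abs_self K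
    linarith
  rw [Real.dist_eq, sub_zero, abs_of_nonneg (integral_nonneg fun x => abs_nonneg _)]
  linarith

theorem tendsto_integral_mul_of_integral_sq_le {T : Type*} {l : Filter T}
    [l.IsCountablyGenerated] {D : T → α → ℝ} {g u : α → ℝ} {K B : ℝ}
    (hD : ∀ᶠ t in l, MemLp (D t) 2 μ) (hg : MemLp g 2 μ)
    (hK : ∀ᶠ t in l, ∫ x, D t x ^ 2 ∂μ ≤ K)
    (hlim : ∀ᵐ x ∂μ, Tendsto (fun t => D t x) l (𝓝 (g x)))
    (hu : AEStronglyMeasurable u μ) (hB : ∀ᵐ x ∂μ, ‖u x‖ ≤ B) :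
    Tendsto (fun t => ∫ x, u x * D t x ∂μ) l (𝓝 (∫ x, u x * g x ∂μ)) := by
  have h0 := tendsto_integral_abs_zero_of_integral_sq_le (μ := μ) (l := l)
    (f := fun t x => D t x - g x) (K := 2 * K + 2 * ∫ x, g x ^ 2 ∂μ)
    (hD.mono fun t ht => ht.sub hg)
    (by
      filter_upwards [hD, hK] with t ht hKt
      calc ∫ x, (D t x - g x) ^ 2 ∂μ ≤ ∫ x, (2 * D t x ^ 2 + 2 * g x ^ 2) ∂μ := by
            refine integral_mono (ht.sub hg).integrable_sq
              ((ht.integrable_sq.const_mul 2).add (hg.integrable_sq.const_mul 2)) fun x => ?_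
            nlinarith [sq_nonneg (D t x + g x)]
        _ = 2 * ∫ x, D t x ^ 2 ∂μ + 2 * ∫ x, g x ^ 2 ∂μ := by
            rw [integral_add (ht.integrable_sq.const_mul 2) (hg.integrable_sq.const_mul 2),
              integral_const_mul, integral_const_mul]
        _ ≤ _ := by linarith)
    (hlim.mono fun x hx => by simpa using hx.sub_const (g x))
  rw [tendsto_iff_norm_sub_tendsto_zero]
  refine squeeze_zero' (Eventually.of_forall fun t => norm_nonneg _) ?_
    (by simpa using h0.const_mul B)
  filter_upwards [hD] with t ht
  have hi := (ht.sub hg).integrable one_le_two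
  rw [← integral_sub ((ht.integrable one_le_two).bdd_mul hu hB)
    ((hg.integrable one_le_two).bdd_mul hu hB), ← integral_const_mul]
  refine norm_integral_le_of_norm_le (hi.abs.const_mul B) (hB.mono fun x hx => ?_)
  rw [← mul_sub, norm_mul]
  exact mul_le_mul_of_nonneg_right hx (norm_nonneg _)

/-- Differentiation of `t ↦ ‖φ t - h‖²` when the difference quotients of `φ` at `0` are bounded in
`L²` and converge almost everywhere. -/
theorem hasDerivAt_integral_sub_sq {φ : ℝ → α → ℝ} {h g : α → ℝ} {K B : ℝ}
    (hφ : ∀ᶠ t in 𝓝 (0 : ℝ), MemLp (φ t) 2 μ) (hg : MemLp g 2 μ)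
    (hK : ∀ᶠ t in 𝓝 (0 : ℝ), ∫ x, (φ t x - φ 0 x) ^ 2 ∂μ ≤ (K * t) ^ 2)
    (hderiv : ∀ᵐ x ∂μ, HasDerivAt (fun t => φ t x) (g x) 0)
    (hh : AEStronglyMeasurable h μ) (hB : ∀ᵐ x ∂μ, ‖φ 0 x - h x‖ ≤ B) :
    HasDerivAt (fun t => ∫ x, (φ t x - h x) ^ 2 ∂μ) (2 * ∫ x, (φ 0 x - h x) * g x ∂μ) 0 := by
  have hφ0 : MemLp (φ 0) 2 μ := hφ.self_of_nhds
  have hu : AEStronglyMeasurable (fun x => φ 0 x - h x) μ := hφ0.aestronglyMeasurable.sub hh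
  have hu2 : MemLp (fun x => φ 0 x - h x) 2 μ := MemLp.of_bound hu B hB
  let D : ℝ → α → ℝ := fun t x => t⁻¹ * (φ t x - φ 0 x)
  have hφ' := nhdsWithin_le_nhds (s := {(0 : ℝ)}ᶜ) hφ
  have hK' := nhdsWithin_le_nhds (s := {(0 : ℝ)}ᶜ) hK
  have hne : ∀ᶠ t in 𝓝[≠] (0 : ℝ), t ≠ 0 := self_mem_nhdsWithin
  have hD : ∀ᶠ t in 𝓝[≠] (0 : ℝ), MemLp (D t) 2 μ :=
    Filter.Eventually.mono hφ' fun t ht => (ht.sub hφ0).const_mul t⁻¹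
  have hDK : ∀ᶠ t in 𝓝[≠] (0 : ℝ), ∫ x, D t x ^ 2 ∂μ ≤ K ^ 2 := by
    filter_upwards [hK', hne] with t ht ht0
    simp only [D, mul_pow, integral_const_mul]
    calc t⁻¹ ^ 2 * ∫ x, (φ t x - φ 0 x) ^ 2 ∂μ ≤ t⁻¹ ^ 2 * (K * t) ^ 2 := by
          gcongr
      _ = K ^ 2 := by field_simp
  have hlim : ∀ᵐ x ∂μ, Tendsto (fun t => D t x) (𝓝[≠] 0) (𝓝 (g x)) := by
    filter_upwards [hderiv] with x hx
    simpa [D] using hasDerivAt_iff_tendsto_slope_zero.1 hx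
  have hcross := tendsto_integral_mul_of_integral_sq_le hD hg hDK hlim hu hB
  -- The quotient of the loss is `t ∫ D² + 2 ∫ (φ 0 - h) D`; boundedness of `∫ D²` alone kills the
  -- first term.
  have hsq : Tendsto (fun t => t * ∫ x, D t x ^ 2 ∂μ) (𝓝[≠] 0) (𝓝 0) := by
    have ht : Tendsto (fun t : ℝ => |t| * K ^ 2) (𝓝[≠] 0) (𝓝 0) := by
      have : Tendsto (fun t : ℝ => |t| * K ^ 2) (𝓝 0) (𝓝 (|0| * K ^ 2)) :=
        (continuous_abs.mul continuous_const).tendsto 0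
      simpa using this.mono_left nhdsWithin_le_nhds
    refine squeeze_zero_norm' ?_ ht
    filter_upwards [hDK] with t htK
    rw [norm_mul, Real.norm_eq_abs, Real.norm_of_nonneg (integral_nonneg fun x => sq_nonneg _)]
    gcongr
  rw [hasDerivAt_iff_tendsto_slope_zero]
  have hsum := hsq.add (hcross.const_mul 2)
  rw [zero_add] at hsum
  refine hsum.congr' ?_
  filter_upwards [hD, hne] with t ht ht0
  have hexp : ∀ x, (φ t x - h x) ^ 2 = t ^ 2 * D t x ^ 2
      + 2 * t * ((φ 0 x - h x) * D t x) + (φ 0 x - h x) ^ 2 := by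
    intro x
    have : φ t x = t * D t x + φ 0 x := by simp only [D]; field_simp; ring
    rw [this]; ring
  have hi1 : Integrable (fun x => t ^ 2 * D t x ^ 2) μ := ht.integrable_sq.const_mul _
  have hi2 : Integrable (fun x => 2 * t * ((φ 0 x - h x) * D t x)) μ :=
    ((ht.integrable one_le_two).bdd_mul hu hB).const_mul _
  have hi12 : Integrable (fun x => t ^ 2 * D t x ^ 2 + 2 * t * ((φ 0 x - h x) * D t x)) μ :=
    hi1.add hi2
  have hint : ∫ x, (φ t x - h x) ^ 2 ∂μ = t ^ 2 * ∫ x, D t x ^ 2 ∂μ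
      + 2 * t * ∫ x, (φ 0 x - h x) * D t x ∂μ + ∫ x, (φ 0 x - h x) ^ 2 ∂μ := by
    simp only [hexp]
    rw [integral_add hi12 hu2.integrable_sq, integral_add hi1 hi2, integral_const_mul,
      integral_const_mul]
  rw [zero_add, smul_eq_mul, hint]
  field_simp
  ring

end Differentiation

/-! ### Variance bound and conclusion -/

/-- The mean minimises the sum of squared deviations, so any convenient centre `c` may replace it.
-/
theorem unifVar_le (A : ℕ) (Y : ℕ → ℝ) (c : ℝ) :
    unifVar A Y ≤ (∑ a ∈ Finset.range A, (Y a - c) ^ 2) / A := by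
  rcases Nat.eq_zero_or_pos A with rfl | hA
  · simp [unifVar, unifMean]
  have hA' : (0 : ℝ) < A := by positivity
  obtain ⟨m, hm⟩ : ∃ m, m = unifMean A Y := ⟨_, rfl⟩
  have hsum : ∑ a ∈ Finset.range A, Y a = A * m := by
    rw [hm, unifMean]; field_simp
  rw [unifVar, ← hm, unifMean]
  gcongr ?_ / _
  have h : ∑ a ∈ Finset.range A, (Y a - c) ^ 2
      = ∑ a ∈ Finset.range A, (Y a - m) ^ 2 + A * (m - c) ^ 2 := by
    have : ∀ a, (Y a - c) ^ 2
        = (Y a - m) ^ 2 + (2 * (m - c) * Y a + (c ^ 2 - m ^ 2)) := fun a => by ring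
    simp only [this, Finset.sum_add_distrib, ← Finset.mul_sum, hsum, Finset.sum_const,
      Finset.card_range, nsmul_eq_mul]
    ring
  rw [h]
  have : 0 ≤ (A : ℝ) * (m - c) ^ 2 := by positivity
  linarith

theorem hasLineDerivAt_loss {ψ : ℝ → ℝ} (hm : Measurable ψ) {V : ℝ} (hV : ∀ x, |ψ x| ≤ V)
    {s : ℕ} {Ω : Set (EuclideanSpace ℝ (Fin s))} (hΩ : IsOpen Ω)
    {η : EuclideanSpace ℝ (Fin s) → ℝ → ℝ}
    (hη : ContinuousOn (Function.uncurry η) (Ω ×ˢ Set.univ))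
    {w : EuclideanSpace ℝ (Fin s)} (hw : w ∈ Ω) (i : Fin s)
    (hd : ∀ᵐ x ∂(volume.restrict (Icc (0 : ℝ) 1)),
      LineDifferentiableAt ℝ (fun v => η v x) w (basisVec i))
    (hg : MemLp (gradFun η w i) 2 (volume.restrict (Icc (0 : ℝ) 1)))
    {K : ℝ} (hK : ∀ᶠ t in 𝓝 (0 : ℝ),
      normSqL2 (fun x => η (w + t • basisVec i) x - η w x) ≤ (K * t) ^ 2) (a : ℕ) :
    HasLineDerivAt ℝ (loss ψ η a)
      (2 * ∫ x in Icc (0 : ℝ) 1, (η w x - wave ψ a x) * gradFun η w i x) w (basisVec i) := by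
  have hcont : ∀ v ∈ Ω, Continuous (η v) := by
    intro v hv
    have h := hη.comp (f := fun x : ℝ => (v, x)) (s := univ) (by fun_prop) fun x _ => ⟨hv, trivial⟩
    exact continuousOn_univ.1 h
  have hbdd : ∀ v ∈ Ω, ∃ B, ∀ᵐ x ∂(volume.restrict (Icc (0 : ℝ) 1)), ‖η v x‖ ≤ B := by
    intro v hv
    obtain ⟨B, hB⟩ := isCompact_Icc.exists_bound_of_continuousOn (hcont v hv).continuousOn
    exact ⟨B, (ae_restrict_mem measurableSet_Icc).mono hB⟩
  have hmem : ∀ v ∈ Ω, MemLp (η v) 2 (volume.restrict (Icc (0 : ℝ) 1)) := by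
    intro v hv
    obtain ⟨B, hB⟩ := hbdd v hv
    exact MemLp.of_bound (hcont v hv).aestronglyMeasurable B hB
  obtain ⟨B, hB⟩ := hbdd w hw
  have hmw : Measurable (wave ψ a) := by unfold wave; fun_prop
  have hnear : ∀ᶠ t in 𝓝 (0 : ℝ), w + t • basisVec i ∈ Ω := by
    have hc : Continuous fun t : ℝ => w + t • basisVec i := by fun_prop
    exact hc.continuousAt.eventually_mem (hΩ.mem_nhds (by simpa using hw))
  have key := hasDerivAt_integral_sub_sq (μ := volume.restrict (Icc (0 : ℝ) 1))
    (φ := fun t => η (w + t • basisVec i)) (h := wave ψ a) (g := gradFun η w i) (K := K)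
    (B := B + V) (hnear.mono fun t ht => hmem _ ht) hg (by simpa [normSqL2] using hK)
    (hd.mono fun x hx => hx.hasLineDerivAt) hmw.aestronglyMeasurable (by
      filter_upwards [hB] with x hx
      refine (norm_sub_le _ _).trans (add_le_add ?_ (hV _))
      simpa using hx)
  simpa [HasLineDerivAt, loss, normSqL2] using key

end HighFreq

end

theorem theorem1 :
    ∃ C A₀ : ℝ, 0 < C ∧ 0 < A₀ ∧
      ∀ (ψ : ℝ → ℝ), Function.Periodic ψ 1 →
        BoundedVariationOn ψ (Set.Icc (0 : ℝ) 1) →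
        (∫ x in Set.Icc (0 : ℝ) 1, ψ x) = 0 →
      ∀ (s : ℕ) (Ω : Set (EuclideanSpace ℝ (Fin s))), IsOpen Ω →
      ∀ (η : EuclideanSpace ℝ (Fin s) → ℝ → ℝ),
        ContinuousOn (Function.uncurry η) (Ω ×ˢ Set.univ) →
      ∀ w ∈ Ω,
        -- the partial derivatives of `η` at `w` exist for almost every `x` and are in `L₂`
        (∀ i : Fin s, ∀ᵐ x ∂(volume.restrict (Set.Icc (0 : ℝ) 1)),
          LineDifferentiableAt ℝ (fun v => η v x) w (HighFreq.basisVec i)) →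
        (∀ i : Fin s,
          MemLp (HighFreq.gradFun η w i) 2 (volume.restrict (Set.Icc (0 : ℝ) 1))) →
        -- the difference quotients of `η` at `w` along the axes are bounded in `L₂`
        (∃ K : ℝ, ∀ i : Fin s, ∀ᶠ t in 𝓝 (0 : ℝ),
          HighFreq.normSqL2 (fun x => η (w + t • HighFreq.basisVec i) x - η w x)
            ≤ (K * t) ^ 2) →
        (∀ (a : ℕ) (i : Fin s),
          LineDifferentiableAt ℝ (HighFreq.loss ψ η a) w (HighFreq.basisVec i)) ∧
        ∀ A : ℕ, A₀ < (A : ℝ) →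
          HighFreq.gradVar ψ η A w
            ≤ C * HighFreq.gradNormSq η w * HighFreq.bvNorm ψ ^ 2
              * (A : ℝ) ^ (-(1 / 2) : ℝ) * (Real.log (A : ℝ) + 1) ^ (5 / 2 : ℝ) := by
  open HighFreq in
  -- The constant `8` is `4`, from squaring the factor `2` in the derivative, times the `2` of
  -- `sum_sq_integral_wave_mul_le`.
  refine ⟨8, 1, by norm_num, by norm_num, ?_⟩
  intro ψ hper hbv hmean s Ω hΩ η hη w hw hd hg hK
  obtain ⟨K, hK⟩ := hK
  rw [integral_Icc_eq_integral_Ioc, ← intervalIntegral.integral_of_le zero_le_one] at hmean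
  have hm := measurable_of_periodic_of_boundedVariationOn hper hbv
  have hV := abs_le_bvNorm hper hbv hmean
  have hloss := fun a i => hasLineDerivAt_loss hm hV hΩ hη hw i (hd i) (hg i) (hK i) a
  refine ⟨fun a i => (hloss a i).lineDifferentiableAt, fun A hA => ?_⟩
  have hA0 : 0 < A := by
    have : (1 : ℝ) < A := hA
    have : 1 < A := by exact_mod_cast this
    omega
  have hη2 : Continuous (η w) := by
    have h := hη.comp (f := fun x : ℝ => (w, x)) (s := univ) (by fun_prop) fun x _ => ⟨hw, trivial⟩
    exact continuousOn_univ.1 h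
  obtain ⟨B, hB⟩ := isCompact_Icc.exists_bound_of_continuousOn (s := Icc (0 : ℝ) 1)
    hη2.continuousOn
  have hcomp : ∀ i, unifVar A (fun a => partialDeriv i (loss ψ η a) w)
      ≤ 8 * (bvNorm ψ ^ 2 * (1 + Real.log A) ^ 2) * normSqL2 (gradFun η w i) / A := by
    intro i
    have hgi := (hg i).integrable one_le_two
    refine (unifVar_le A _ (2 * ∫ x in Icc (0 : ℝ) 1, η w x * gradFun η w i x)).trans ?_
    gcongr ?_ / _
    have hterm : ∀ a, (partialDeriv i (loss ψ η a) w
          - 2 * ∫ x in Icc (0 : ℝ) 1, η w x * gradFun η w i x) ^ 2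
        = 4 * (∫ x in Icc (0 : ℝ) 1, wave ψ a x * gradFun η w i x) ^ 2 := by
      intro a
      have hmw : Measurable (wave ψ a) := by unfold wave; fun_prop
      rw [partialDeriv, (hloss a i).lineDeriv]
      simp_rw [sub_mul]
      rw [integral_sub
        (hgi.bdd_mul hη2.aestronglyMeasurable ((ae_restrict_mem measurableSet_Icc).mono hB))
        (hgi.bdd_mul hmw.aestronglyMeasurable (Eventually.of_forall fun x => hV _))]
      ring
    simp only [hterm, ← Finset.mul_sum]
    have := sum_sq_integral_wave_mul_le hper hbv hmean (hg i) hA0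
    linarith
  have hL : 1 ≤ Real.log A + 1 := by
    have := Real.log_natCast_nonneg A
    linarith
  have hG : 0 ≤ gradNormSq η w :=
    Finset.sum_nonneg fun i _ => integral_nonneg fun x => sq_nonneg _
  calc gradVar ψ η A w
      ≤ ∑ i, 8 * (bvNorm ψ ^ 2 * (1 + Real.log A) ^ 2) * normSqL2 (gradFun η w i) / A :=
        Finset.sum_le_sum fun i _ => hcomp i
    _ = 8 * gradNormSq η w * bvNorm ψ ^ 2 * (A : ℝ) ^ (-1 : ℝ)
          * (Real.log A + 1) ^ (2 : ℝ) := by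
        rw [← Finset.sum_div, ← Finset.mul_sum, ← gradNormSq, Real.rpow_neg_one, Real.rpow_two]
        ring
    -- Both `A` and `log A + 1` are at least `1`, so raising the exponents from `-1` to `-1/2` and
    -- from `2` to `5/2` only increases the bound.
    _ ≤ _ := by
        gcongr
        · exact hA.le
        all_goals norm_num
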